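/- Let $\mathcal A:\mathbb R^{n_1\times n_2}\to\mathbb R^m$ be a linear map. For real $s>0$, $\mathcal A$ satisfies the restricted isometry property (RIP) of order $s$ with constant $\delta_s$ if $\delta_s$ is the smallest $\delta\in[0,1)$ such that $$(1-\delta)\|Z\|_F^2\le\|\mathcal A(Z)\|_2^2\le(1+\delta)\|Z\|_F^2$$ for all $Z\in\mathbb R^{n_1\times n_2}$ of rank at most $\lceil s\rceil$. Let $k\ge1$ be an integer and $t>1$ a real number, and suppose that $\mathcal A$ satisfies the RIP of order $tk$ with constant $\delta=\delta_{tk}<\sqrt{(t-1)/t}$. Let $X\in\mathbb R^{n_1\times n_2}$ have the singular value decomposition $X=\sum_{i=1}^{\min(n_1,n_2)}\sigma_i(X)\,u_iv_i^T$ with $\sigma_1(X)\ge\sigma_2(X)\ge\cdots$, and let $X_{[k]}=\sum_{i\le k}\sigma_i(X)\,u_iv_i^T$. Let $b=\mathcal A(X)+n$ with $\|n\|_2\le\epsilon$, let $\lambda>0$, and let $X^\sharp$ be a minimizer over $Z\in\mathbb R^{n_1\times n_2}$ of $$\|Z\|_*+\frac1{2\lambda}\|b-\mathcal A(Z)\|_2^2,$$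 where $\|\cdot\|_*$ is the nuclear norm (the sum of the singular values). Then $$\|\mathcal A(X^\sharp-X)\|_2\le C_1\|X-X_{[k]}\|_*+C_2,\qquad \|X^\sharp-X\|_F\le C_3\|X-X_{[k]}\|_*+C_4,$$ where $$\beta_1=\frac{2}{(1-\delta)\sqrt{1+\delta}},\qquad \beta_2=\frac{\delta}{\sqrt{(1-\delta^2)(t-1)}},$$ $$C_1=\frac{2\lambda}{\sqrt k\beta_1\lambda+\epsilon},\qquad C_2=2\sqrt k\beta_1\lambda+2\epsilon,$$ $$C_3=\frac{2\sqrt k\beta_1(2\sqrt k+1+\beta_2)\lambda+2(\sqrt k\beta_2+2\beta_2+\sqrt k)\epsilon}{k\beta_1(1-\beta_2)\lambda},$$ $$C_4=\frac{\bigl(2(k+\sqrt k)\beta_1\lambda+(\beta_2+2\sqrt k-\sqrt k\beta_2)\epsilon\bigr)\,(\sqrt k\beta_1\lambda+\epsilon)}{\sqrt k(1-\beta_2)\lambda}.$$ -/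

import Mathlib

namespace RNNM

noncomputable section

variable {n₁ n₂ m : ℕ}

/-- The `i`-th singular value of a real matrix in decreasing order, counted from `i = 0`; it is `0`
for `i ≥ min n₁ n₂`. -/
def sv (X : Matrix (Fin n₁) (Fin n₂) ℝ) (i : ℕ) : ℝ :=
  (Matrix.toEuclideanLin X).singularValues i

/-- The nuclear norm: the sum of the singular values. -/
def nuclearNorm (X : Matrix (Fin n₁) (Fin n₂) ℝ) : ℝ :=
  ∑ i : Fin (min n₁ n₂), sv X i

/-- The Frobenius norm. -/
def frobeniusNorm (X : Matrix (Fin n₁) (Fin n₂) ℝ) : ℝ :=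
  letI := Matrix.frobeniusNormedAddCommGroup (m := Fin n₁) (n := Fin n₂) (α := ℝ)
  ‖X‖

/-- A singular value decomposition `X = ∑ i, σ_i(X) u_i v_iᵀ`, with orthonormal left and right
singular vectors. -/
structure SVD (X : Matrix (Fin n₁) (Fin n₂) ℝ) where
  /-- left singular vectors -/
  u : Fin (min n₁ n₂) → EuclideanSpace ℝ (Fin n₁)
  /-- right singular vectors -/
  v : Fin (min n₁ n₂) → EuclideanSpace ℝ (Fin n₂)
  orthonormal_u : Orthonormal ℝ u
  orthonormal_v : Orthonormal ℝ v
  eq_sum : X = ∑ i : Fin (min n₁ n₂), sv X i • Matrix.vecMulVec (u i) (v i)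

/-- The truncation `X_{[k]}`: the part of the decomposition that belongs to the `k` largest singular
values. -/
def SVD.trunc {X : Matrix (Fin n₁) (Fin n₂) ℝ} (S : SVD X) (k : ℕ) :
    Matrix (Fin n₁) (Fin n₂) ℝ :=
  ∑ i ∈ Finset.univ.filter (fun i : Fin (min n₁ n₂) => (i : ℕ) < k), sv X i • Matrix.vecMulVec (S.u i) (S.v i)

/-- `δ` satisfies the restricted isometry inequalities for `𝒜` on the matrices of rank at most
`r`. -/
def HasRIP (𝒜 : Matrix (Fin n₁) (Fin n₂) ℝ →ₗ[ℝ] EuclideanSpace ℝ (Fin m)) (r : ℕ) (δ : ℝ) :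
    Prop :=
  ∀ X : Matrix (Fin n₁) (Fin n₂) ℝ, X.rank ≤ r →
    (1 - δ) * frobeniusNorm X ^ 2 ≤ ‖𝒜 X‖ ^ 2 ∧
      ‖𝒜 X‖ ^ 2 ≤ (1 + δ) * frobeniusNorm X ^ 2

/-- `𝒜` satisfies the restricted isometry property of the real order `s`, and `δ = δ_s` is its
restricted isometry constant: the least admissible value in `[0, 1)` for matrices of rank at most
`⌈s⌉`. -/
def IsRIC (𝒜 : Matrix (Fin n₁) (Fin n₂) ℝ →ₗ[ℝ] EuclideanSpace ℝ (Fin m)) (s δ : ℝ) : Prop :=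
  IsLeast {d : ℝ | 0 ≤ d ∧ d < 1 ∧ HasRIP 𝒜 ⌈s⌉₊ d} δ

/-- The objective of regularized nuclear norm minimization. -/
def objective (𝒜 : Matrix (Fin n₁) (Fin n₂) ℝ →ₗ[ℝ] EuclideanSpace ℝ (Fin m))
    (b : EuclideanSpace ℝ (Fin m)) (lam : ℝ) (Z : Matrix (Fin n₁) (Fin n₂) ℝ) : ℝ :=
  nuclearNorm Z + 1 / (2 * lam) * ‖b - 𝒜 Z‖ ^ 2

/-- `β₁` -/
def beta1 (δ : ℝ) : ℝ := 2 / ((1 - δ) * √(1 + δ))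

/-- `β₂` -/
def beta2 (t δ : ℝ) : ℝ := δ / √((1 - δ ^ 2) * (t - 1))

/-- `C₁` -/
def C1 (lam ε k δ : ℝ) : ℝ := 2 * lam / (√k * beta1 δ * lam + ε)

/-- `C₂` -/
def C2 (lam ε k δ : ℝ) : ℝ := 2 * √k * beta1 δ * lam + 2 * ε

/-- `C₃` -/
def C3 (lam ε k δ t : ℝ) : ℝ :=
  (2 * √k * beta1 δ * (2 * √k + 1 + beta2 t δ) * lam
      + 2 * (√k * beta2 t δ + 2 * beta2 t δ + √k) * ε)
    / (k * beta1 δ * (1 - beta2 t δ) * lam)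

/-- `C₄` -/
def C4 (lam ε k δ t : ℝ) : ℝ :=
  (2 * (k + √k) * beta1 δ * lam + (beta2 t δ + 2 * √k - √k * beta2 t δ) * ε)
    / (√k * (1 - beta2 t δ) * lam * (√k * beta1 δ * lam + ε)⁻¹)

end

end RNNM

/-! Put H = X - X', r = ‖𝒜 H‖, and let y be the sum of the singular values of H after the k-th.
Three facts are combined. Optimality: comparing the objective at X' and X bounds r² - 2εr by
2λ(‖X‖_* - ‖X'‖_*). Cone condition: the gap "top k singular values minus the others" is 1-Lipschitz
for the nuclear norm (`svGap_sub_le`); since X - H = X', that difference is at most 2‖X - X_[k]‖_*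
plus the gap of H. Null space property: `HasRIP.sqrt_sum_sq_le` bounds the ℓ² norm of the top k
singular values of H by β₁ r + β₂ y / √k. The result is a quadratic inequality in r with an extra
term -2λ(1 - β₂) y; the assumption on δ says β₂ < 1, so both r and y are controlled
(`error_bounds`).

For the null space property the singular vectors of H stay fixed and only coefficients change. The
head and the large tail entries are kept; the small entries are replaced by a constant on a small
support, the minimizer of a linear functional (`exists_subset_card_le_mul_sum_le`), and the RIP
applies to what remains. -/

namespace RNNM

open scoped InnerProductSpace

variable {n₁ n₂ m : ℕ}

/-! ### Frobenius geometry and combinations of dyads. -/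

/-- The Frobenius inner product. -/
noncomputable def frobeniusInner :
    Matrix (Fin n₁) (Fin n₂) ℝ →ₗ[ℝ] Matrix (Fin n₁) (Fin n₂) ℝ →ₗ[ℝ] ℝ :=
  LinearMap.mk₂ ℝ (fun A B => ∑ i, ∑ j, A i j * B i j)
    (by intros; simp [add_mul, Finset.sum_add_distrib])
    (by intros; simp [Finset.mul_sum, mul_assoc])
    (by intros; simp [mul_add, Finset.sum_add_distrib])
    (by intros; simp [Finset.mul_sum, mul_left_comm])

theorem frobeniusInner_apply (A B : Matrix (Fin n₁) (Fin n₂) ℝ) :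
    frobeniusInner A B = ∑ i, ∑ j, A i j * B i j := rfl

theorem frobeniusNorm_nonneg (A : Matrix (Fin n₁) (Fin n₂) ℝ) : 0 ≤ frobeniusNorm A :=
  letI := Matrix.frobeniusNormedAddCommGroup (m := Fin n₁) (n := Fin n₂) (α := ℝ)
  norm_nonneg A

theorem frobeniusNorm_sq (A : Matrix (Fin n₁) (Fin n₂) ℝ) :
    frobeniusNorm A ^ 2 = frobeniusInner A A := by
  have h : frobeniusNorm A = (∑ i, ∑ j, ‖A i j‖ ^ (2 : ℝ)) ^ (1 / 2 : ℝ) :=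
    Matrix.frobenius_norm_def A
  rw [h, ← Real.sqrt_eq_rpow, Real.sq_sqrt (by positivity), frobeniusInner_apply]
  simp [pow_two]

theorem frobeniusInner_vecMulVec (u u' : EuclideanSpace ℝ (Fin n₁))
    (v v' : EuclideanSpace ℝ (Fin n₂)) :
    frobeniusInner (Matrix.vecMulVec u v) (Matrix.vecMulVec u' v') = ⟪u, u'⟫_ℝ * ⟪v, v'⟫_ℝ := by
  simp only [frobeniusInner_apply, Matrix.vecMulVec_apply, PiLp.inner_apply, Finset.sum_mul_sum]
  refine Finset.sum_congr rfl fun i _ => Finset.sum_congr rfl fun j _ => ?_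
  simp; ring

/-- The linear combination `∑ i, c i • u i (v i)ᵀ` of dyads. -/
noncomputable def dyadSum {ι : Type*} [Fintype ι] (u : ι → EuclideanSpace ℝ (Fin n₁))
    (v : ι → EuclideanSpace ℝ (Fin n₂)) : (ι → ℝ) →ₗ[ℝ] Matrix (Fin n₁) (Fin n₂) ℝ :=
  Fintype.linearCombination ℝ (fun i => Matrix.vecMulVec (u i) (v i))

section dyadSum

variable {ι κ : Type*} [Fintype ι] [Fintype κ] {u : ι → EuclideanSpace ℝ (Fin n₁)}
  {v : ι → EuclideanSpace ℝ (Fin n₂)} {u' : κ → EuclideanSpace ℝ (Fin n₁)}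
  {v' : κ → EuclideanSpace ℝ (Fin n₂)}

theorem dyadSum_apply (c : ι → ℝ) :
    dyadSum u v c = ∑ i, c i • Matrix.vecMulVec (u i) (v i) := rfl

theorem frobeniusInner_dyadSum (c : ι → ℝ) (d : κ → ℝ) :
    frobeniusInner (dyadSum u v c) (dyadSum u' v' d) =
      ∑ i, c i * ∑ j, d j * (⟪u i, u' j⟫_ℝ * ⟪v i, v' j⟫_ℝ) := by
  simp only [dyadSum_apply, map_sum, map_smul, LinearMap.sum_apply, LinearMap.smul_apply,
    smul_eq_mul, frobeniusInner_vecMulVec, Finset.mul_sum]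
  rw [Finset.sum_comm]
  refine Finset.sum_congr rfl fun i _ => Finset.sum_congr rfl fun j _ => ?_
  ring

theorem frobeniusInner_dyadSum_self (hu : Orthonormal ℝ u) (hv : Orthonormal ℝ v)
    (c d : ι → ℝ) : frobeniusInner (dyadSum u v c) (dyadSum u v d) = ∑ i, c i * d i := by
  classical
  rw [frobeniusInner_dyadSum]
  refine Finset.sum_congr rfl fun i _ => ?_
  rw [Finset.sum_eq_single i]
  · rw [orthonormal_iff_ite.mp hu, orthonormal_iff_ite.mp hv]
    simp
  · intro j _ hj
    simp [orthonormal_iff_ite.mp hu, hj.symm]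
  · simp

theorem frobeniusNorm_dyadSum_sq (hu : Orthonormal ℝ u) (hv : Orthonormal ℝ v) (c : ι → ℝ) :
    frobeniusNorm (dyadSum u v c) ^ 2 = ∑ i, c i ^ 2 := by
  rw [frobeniusNorm_sq, frobeniusInner_dyadSum_self hu hv]
  simp [pow_two]

theorem matrix_rank_add_le (A B : Matrix (Fin n₁) (Fin n₂) ℝ) :
    (A + B).rank ≤ A.rank + B.rank := by
  have h : LinearMap.range (A + B).mulVecLin ≤
      LinearMap.range A.mulVecLin ⊔ LinearMap.range B.mulVecLin := by
    rw [Matrix.mulVecLin_add]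
    exact LinearMap.range_add_le _ _
  exact (Submodule.finrank_mono h).trans (Submodule.finrank_add_le_finrank_add_finrank _ _)

theorem rank_sum_vecMulVec_le {ι : Type*} (u : ι → EuclideanSpace ℝ (Fin n₁))
    (v : ι → EuclideanSpace ℝ (Fin n₂)) (s : Finset ι) (c : ι → ℝ) :
    (∑ i ∈ s, c i • Matrix.vecMulVec (u i) (v i) : Matrix (Fin n₁) (Fin n₂) ℝ).rank ≤ s.card := by
  classical
  induction s using Finset.induction_on with
  | empty => simp
  | insert a s ha ih =>
    rw [Finset.sum_insert ha, Finset.card_insert_of_notMem ha, add_comm]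
    refine (matrix_rank_add_le _ _).trans (add_le_add ih ?_)
    rw [← Matrix.smul_vecMulVec (c a)]
    exact Matrix.rank_vecMulVec_le _ _

theorem rank_dyadSum_le (s : Finset ι) (c : ι → ℝ) (hc : ∀ i ∉ s, c i = 0) :
    (dyadSum u v c).rank ≤ s.card := by
  rw [dyadSum_apply, ← Finset.sum_subset (Finset.subset_univ s)]
  · exact rank_sum_vecMulVec_le u v s c
  · intro i _ hi
    simp [hc i hi]

end dyadSum

/-! ### Singular values and existence of the decomposition. -/

theorem sv_nonneg (Z : Matrix (Fin n₁) (Fin n₂) ℝ) (i : ℕ) : 0 ≤ sv Z i :=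
  LinearMap.singularValues_nonneg _ _

theorem sv_antitone (Z : Matrix (Fin n₁) (Fin n₂) ℝ) : Antitone (sv Z) :=
  LinearMap.singularValues_antitone _

theorem nuclearNorm_nonneg (Z : Matrix (Fin n₁) (Fin n₂) ℝ) : 0 ≤ nuclearNorm Z :=
  Finset.sum_nonneg fun i _ => sv_nonneg Z i

theorem SVD.eq_dyadSum {Z : Matrix (Fin n₁) (Fin n₂) ℝ} (S : SVD Z) :
    Z = dyadSum S.u S.v (fun i => sv Z i) := S.eq_sum

theorem toEuclideanLin_vecMulVec (u : EuclideanSpace ℝ (Fin n₁)) (v x : EuclideanSpace ℝ (Fin n₂)) :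
    Matrix.toEuclideanLin (Matrix.vecMulVec u v) x = ⟪v, x⟫_ℝ • u := by
  ext i
  simp [Matrix.toLpLin_apply, Matrix.mulVec, dotProduct, Matrix.vecMulVec_apply, PiLp.inner_apply,
    Finset.sum_mul]
  exact Finset.sum_congr rfl fun j _ => by ring

/-- Every real matrix has a singular value decomposition. -/
theorem nonempty_SVD (Z : Matrix (Fin n₁) (Fin n₂) ℝ) : Nonempty (SVD Z) := by
  set T := Matrix.toEuclideanLin Z with hT
  have hn : Module.finrank ℝ (EuclideanSpace ℝ (Fin n₂)) = n₂ := finrank_euclideanSpace_fin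
  have hsym := T.isSymmetric_adjoint_comp_self
  set e := hsym.eigenvectorBasis hn with he
  have hsv : ∀ i, sv Z i = T.singularValues i := fun i => rfl
  have hTe : ∀ i j, ⟪T (e i), T (e j)⟫_ℝ = if i = j then sv Z i ^ 2 else 0 := by
    intro i j
    rw [← LinearMap.adjoint_inner_left, ← LinearMap.comp_apply, he,
      hsym.apply_eigenvectorBasis hn i, inner_smul_left, ← he,
      orthonormal_iff_ite.mp e.orthonormal, hsv, T.sq_singularValues_fin hn]
    simp
  have hTe0 : ∀ i : Fin n₂, sv Z i = 0 → T (e i) = 0 := by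
    intro i hi
    have := hTe i i
    simpa [hi] using this
  -- The left vectors are the normalized images of the right ones. They are orthonormal only where
  -- the singular value is positive; extending to a basis fills the other indices.
  let w : Fin n₁ → EuclideanSpace ℝ (Fin n₁) := fun i =>
    if h : (i : ℕ) < n₂ then (sv Z i)⁻¹ • T (e ⟨i, h⟩) else 0
  let s : Set (Fin n₁) := {i | 0 < sv Z i}
  have hs : ∀ i ∈ s, (i : ℕ) < n₂ := by
    intro i hi
    by_contra! h
    have h0 : sv Z i = 0 := T.singularValues_of_finrank_le (hn.trans_le h)
    exact absurd (show 0 < sv Z i from hi) (by simp [h0])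
  have hw : Orthonormal ℝ (s.domRestrict w) := by
    classical
    rw [orthonormal_iff_ite]
    rintro ⟨i, hi⟩ ⟨j, hj⟩
    have hi' : sv Z i ≠ 0 := (show 0 < sv Z i from hi).ne'
    simp only [Set.domRestrict_apply, w, hs i hi, hs j hj, dif_pos, inner_smul_left,
      inner_smul_right, hTe, Fin.mk.injEq, Subtype.mk.injEq, Fin.val_inj]
    split_ifs with h
    · subst h
      simp
      field_simp
    · simp
  obtain ⟨c, hc⟩ := hw.exists_orthonormalBasis_extension_of_card_eq (by simp)
  let f₁ : Fin (min n₁ n₂) → Fin n₁ := Fin.castLE (min_le_left _ _)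
  let f₂ : Fin (min n₁ n₂) → Fin n₂ := Fin.castLE (min_le_right _ _)
  have hf₁ : Function.Injective f₁ := Fin.castLE_injective _
  have hf₂ : Function.Injective f₂ := Fin.castLE_injective _
  refine ⟨⟨c ∘ f₁, e ∘ f₂, c.orthonormal.comp _ hf₁, e.orthonormal.comp _ hf₂, ?_⟩⟩
  apply Matrix.toEuclideanLin.injective
  refine e.toBasis.ext fun j => ?_
  simp only [map_sum, map_smul, LinearMap.sum_apply, LinearMap.smul_apply,
    toEuclideanLin_vecMulVec, OrthonormalBasis.coe_toBasis, Function.comp_apply,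
    orthonormal_iff_ite.mp e.orthonormal]
  rw [← hT]
  by_cases hj : (j : ℕ) < n₁
  · let i : Fin (min n₁ n₂) := ⟨j, lt_min hj j.2⟩
    rw [Finset.sum_eq_single i]
    · have hij : f₂ i = j := rfl
      rcases (sv_nonneg Z j).eq_or_lt with h0 | h0
      · rw [hTe0 j h0.symm]
        simp [i, ← h0]
      · have hci : c (f₁ i) = (sv Z j)⁻¹ • T (e j) := by
          rw [hc (f₁ i) h0]
          simp [w, f₁, i]
        rw [hci]
        simp only [hij, i, if_true, one_smul]
        rw [smul_inv_smul₀ h0.ne']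
    · intro b _ hb
      have : f₂ b ≠ j := fun h => hb (Fin.ext (by simpa [f₂, Fin.ext_iff, i] using h))
      simp [this]
    · simp
  -- Here `j ≥ n₁`: the rank is at most `n₁`, so this eigenvector is in the kernel and no dyad is
  -- needed for it.
  · have h0 : sv Z j = 0 := by
      rw [hsv, LinearMap.singularValues_eq_zero_iff_le_finrank_range]
      refine (Submodule.finrank_le _).trans ?_
      rw [finrank_euclideanSpace_fin]
      exact not_lt.mp hj
    rw [hTe0 j h0, Finset.sum_eq_zero]
    intro b _
    have : f₂ b ≠ j := fun h => hj (by
      have := congrArg Fin.val h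
      simp only [f₂, Fin.val_castLE] at this
      rw [← this]
      exact (lt_min_iff.mp b.2).1)
    simp [this]

/-! ### Nuclear norm duality and Ky Fan's inequality. -/

section bessel

variable {ι κ : Type*} [Fintype ι] [Fintype κ] {u : ι → EuclideanSpace ℝ (Fin n₁)}
  {v : ι → EuclideanSpace ℝ (Fin n₂)}

/-- AM-GM on each product, then Bessel for both families. -/
theorem sum_abs_inner_mul_inner_le_one (hu : Orthonormal ℝ u) (hv : Orthonormal ℝ v)
    (x : EuclideanSpace ℝ (Fin n₁)) (y : EuclideanSpace ℝ (Fin n₂)) (hx : ‖x‖ = 1)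
    (hy : ‖y‖ = 1) : ∑ j, |⟪u j, x⟫_ℝ * ⟪v j, y⟫_ℝ| ≤ 1 := by
  have h1 := hu.sum_inner_products_le x (s := Finset.univ)
  have h2 := hv.sum_inner_products_le y (s := Finset.univ)
  rw [hx] at h1
  rw [hy] at h2
  have h3 : ∀ j, |⟪u j, x⟫_ℝ * ⟪v j, y⟫_ℝ| ≤ (‖⟪u j, x⟫_ℝ‖ ^ 2 + ‖⟪v j, y⟫_ℝ‖ ^ 2) / 2 := by
    intro j
    rw [abs_mul, Real.norm_eq_abs, Real.norm_eq_abs]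
    nlinarith [sq_nonneg (|⟪u j, x⟫_ℝ| - |⟪v j, y⟫_ℝ|)]
  calc _ ≤ ∑ j, (‖⟪u j, x⟫_ℝ‖ ^ 2 + ‖⟪v j, y⟫_ℝ‖ ^ 2) / 2 := Finset.sum_le_sum fun j _ => h3 j
    _ ≤ 1 := by
      rw [← Finset.sum_div, Finset.sum_add_distrib]
      linarith

end bessel

/-- The sum of the `k` largest singular values. -/
noncomputable def kyFan (k : ℕ) (Z : Matrix (Fin n₁) (Fin n₂) ℝ) : ℝ :=
  ∑ i : Fin (min n₁ n₂), if (i : ℕ) < k then sv Z i else 0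

/-- The partial isometry built from the first `k` pairs of singular vectors. -/
noncomputable def SVD.head {Z : Matrix (Fin n₁) (Fin n₂) ℝ} (S : SVD Z) (k : ℕ) :
    Matrix (Fin n₁) (Fin n₂) ℝ :=
  dyadSum S.u S.v (fun i => if (i : ℕ) < k then 1 else 0)

theorem SVD.frobeniusInner_dyadSum {Z : Matrix (Fin n₁) (Fin n₂) ℝ} (S : SVD Z)
    (c : Fin (min n₁ n₂) → ℝ) :
    frobeniusInner Z (dyadSum S.u S.v c) = ∑ i : Fin (min n₁ n₂), sv Z i * c i := by
  have h := frobeniusInner_dyadSum_self S.orthonormal_u S.orthonormal_v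
    (fun i : Fin (min n₁ n₂) => sv Z i) c
  rwa [← S.eq_dyadSum] at h

theorem SVD.frobeniusInner_head {Z : Matrix (Fin n₁) (Fin n₂) ℝ} (S : SVD Z) (k : ℕ) :
    frobeniusInner Z (S.head k) = kyFan k Z := by
  simp [SVD.head, S.frobeniusInner_dyadSum, kyFan]

/-- Each dyad of a decomposition of `B` pairs to at most 1 with the dyad sum, by Bessel. This half
of duality supplies all lower bounds on nuclear norms. -/
theorem frobeniusInner_dyadSum_le_nuclearNorm {ι : Type*} [Fintype ι]
    {u : ι → EuclideanSpace ℝ (Fin n₁)} {v : ι → EuclideanSpace ℝ (Fin n₂)}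
    (hu : Orthonormal ℝ u) (hv : Orthonormal ℝ v) (c : ι → ℝ) (hc : ∀ i, |c i| ≤ 1)
    (B : Matrix (Fin n₁) (Fin n₂) ℝ) :
    frobeniusInner B (dyadSum u v c) ≤ nuclearNorm B := by
  obtain ⟨S⟩ := nonempty_SVD B
  conv_lhs => rw [S.eq_dyadSum, RNNM.frobeniusInner_dyadSum]
  refine Finset.sum_le_sum fun i _ => mul_le_of_le_one_right (sv_nonneg B i) ?_
  refine le_trans (Finset.sum_le_sum fun j _ => ?_)
    (sum_abs_inner_mul_inner_le_one hu hv (S.u i) (S.v i) (S.orthonormal_u.1 i)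
      (S.orthonormal_v.1 i))
  rw [real_inner_comm, real_inner_comm (v j)]
  refine (le_abs_self _).trans ?_
  rw [abs_mul]
  exact mul_le_of_le_one_left (abs_nonneg _) (hc j)

/-- Compare with the threshold `s k`: pointwise (s i - s k)(|d i| - 1_{i<k}) ≤ 0, and the total mass
of |d| is at most k. -/
theorem sum_mul_le_sum_initial {p k : ℕ} (hk : k ≤ p) {s : ℕ → ℝ} (hs : Antitone s)
    (h0 : ∀ i, 0 ≤ s i) (d : Fin p → ℝ) (hd : ∀ i, |d i| ≤ 1) (hd' : ∑ i, |d i| ≤ k) :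
    ∑ i : Fin p, s i * d i ≤ ∑ i : Fin p, if (i : ℕ) < k then s i else 0 := by
  have hpt : ∀ i : Fin p, s i * d i - (if (i : ℕ) < k then s i else 0) ≤
      s k * (|d i| - if (i : ℕ) < k then 1 else 0) := by
    intro i
    have h1 := hd i
    have h2 := le_abs_self (d i)
    split_ifs with h
    · nlinarith [hs h.le, h0 i, h0 k]
    · have := hs (not_lt.mp h)
      nlinarith [h0 i, abs_nonneg (d i)]
  have hsum := Finset.sum_le_sum fun i (_ : i ∈ Finset.univ) => hpt i
  rw [Finset.sum_sub_distrib, ← Finset.mul_sum, Finset.sum_sub_distrib, Finset.sum_boole,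
    Fin.card_filter_val_lt, min_eq_right hk] at hsum
  have := mul_nonneg (h0 k) (sub_nonneg.mpr hd')
  linarith

/-- Ky Fan's inequality. -/
theorem SVD.frobeniusInner_head_le {Z : Matrix (Fin n₁) (Fin n₂) ℝ} (S : SVD Z) (k : ℕ)
    (B : Matrix (Fin n₁) (Fin n₂) ℝ) : frobeniusInner B (S.head k) ≤ kyFan k B := by
  rcases le_total k (min n₁ n₂) with hk | hk
  · obtain ⟨S'⟩ := nonempty_SVD B
    conv_lhs => rw [S'.eq_dyadSum, SVD.head, RNNM.frobeniusInner_dyadSum]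
    have hle : ∀ i j : Fin (min n₁ n₂), |(if (j : ℕ) < k then (1 : ℝ) else 0) *
        (⟪S'.u i, S.u j⟫_ℝ * ⟪S'.v i, S.v j⟫_ℝ)| =
          if (j : ℕ) < k then |⟪S'.u i, S.u j⟫_ℝ * ⟪S'.v i, S.v j⟫_ℝ| else 0 := by
      intro i j
      split_ifs <;> simp
    -- The weight at i sums the products of inner products over j < k. Bessel over j bounds each
    -- weight by 1; Bessel over i bounds their total by k.
    refine sum_mul_le_sum_initial hk (sv_antitone B) (sv_nonneg B) _ (fun i => ?_) ?_
    · refine (Finset.abs_sum_le_sum_abs _ _).trans ?_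
      refine le_trans (Finset.sum_le_sum fun j _ => ?_)
        (sum_abs_inner_mul_inner_le_one S.orthonormal_u S.orthonormal_v (S'.u i) (S'.v i)
          (S'.orthonormal_u.1 i) (S'.orthonormal_v.1 i))
      rw [hle, real_inner_comm, real_inner_comm (S.v j)]
      split_ifs
      · exact le_rfl
      · exact abs_nonneg _
    · refine (Finset.sum_le_sum fun i _ => Finset.abs_sum_le_sum_abs _ _).trans ?_
      rw [Finset.sum_comm]
      calc _ ≤ ∑ j : Fin (min n₁ n₂), (if (j : ℕ) < k then (1 : ℝ) else 0) := by
            refine Finset.sum_le_sum fun j _ => ?_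
            simp only [hle]
            split_ifs
            · exact sum_abs_inner_mul_inner_le_one S'.orthonormal_u S'.orthonormal_v _ _
                (S.orthonormal_u.1 j) (S.orthonormal_v.1 j)
            · simp
        _ = k := by rw [Finset.sum_boole, Fin.card_filter_val_lt, min_eq_right hk]
  · have h1 : kyFan k B = nuclearNorm B :=
      Finset.sum_congr rfl fun i _ => if_pos (i.2.trans_le hk)
    rw [h1]
    refine frobeniusInner_dyadSum_le_nuclearNorm S.orthonormal_u S.orthonormal_v _ (fun i => ?_) B
    split_ifs <;> simp

theorem SVD.abs_frobeniusInner_head_le {Z : Matrix (Fin n₁) (Fin n₂) ℝ} (S : SVD Z) (k : ℕ)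
    (B : Matrix (Fin n₁) (Fin n₂) ℝ) : |frobeniusInner B (S.head k)| ≤ nuclearNorm B := by
  rw [abs_le']
  constructor
  · refine frobeniusInner_dyadSum_le_nuclearNorm S.orthonormal_u S.orthonormal_v _ (fun i => ?_) B
    split_ifs <;> simp
  · rw [SVD.head, ← map_neg, ← map_neg]
    refine frobeniusInner_dyadSum_le_nuclearNorm S.orthonormal_u S.orthonormal_v _ (fun i => ?_) B
    rw [Pi.neg_apply]
    split_ifs <;> simp

/-! ### A Mirsky type inequality for the singular value gap. -/

/-- The sum of the `k` largest singular values minus the sum of the others. -/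
noncomputable def svGap (k : ℕ) (Z : Matrix (Fin n₁) (Fin n₂) ℝ) : ℝ :=
  2 * kyFan k Z - nuclearNorm Z

/-- Ky Fan's inequality at `A` bounds the growth of the top sum by h⟨R, head'⟩, and duality bounds
the nuclear norm from below with the full isometry of `A`. Twice the head minus that isometry has
coefficients ±1, so it pairs with `R` to at most ‖R‖_*. -/
theorem svGap_step (k : ℕ) {A R : Matrix (Fin n₁) (Fin n₂) ℝ} {h : ℝ} (hh : 0 ≤ h) (S : SVD A)
    (S' : SVD (A + h • R)) :
    svGap k (A + h • R) - svGap k A ≤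
      h * (nuclearNorm R + 2 * frobeniusInner R (S'.head k) - 2 * frobeniusInner R (S.head k)) := by
  have h1 := S'.frobeniusInner_head k
  have h2 := S'.frobeniusInner_head_le k A
  have h3 : frobeniusInner (A + h • R) (dyadSum S.u S.v 1) ≤ nuclearNorm (A + h • R) :=
    frobeniusInner_dyadSum_le_nuclearNorm S.orthonormal_u S.orthonormal_v _ (by simp) _
  have h4 : frobeniusInner A (dyadSum S.u S.v 1) = nuclearNorm A := by
    simp [S.frobeniusInner_dyadSum, nuclearNorm]
  have h5 : frobeniusInner R ((2 : ℝ) • S.head k - dyadSum S.u S.v 1) ≤ nuclearNorm R := by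
    rw [SVD.head, ← map_smul, ← map_sub]
    refine frobeniusInner_dyadSum_le_nuclearNorm S.orthonormal_u S.orthonormal_v _ (fun i => ?_) _
    simp only [Pi.sub_apply, Pi.smul_apply, Pi.one_apply]
    split_ifs <;> norm_num
  simp only [map_add, map_smul, LinearMap.add_apply, LinearMap.smul_apply, smul_eq_mul,
    map_sub] at h1 h3 h5
  unfold svGap
  nlinarith [mul_le_mul_of_nonneg_left h5 hh]

/-- A Mirsky type inequality: `svGap k` is `1`-Lipschitz for the nuclear norm. -/
theorem svGap_sub_le (k : ℕ) (A B : Matrix (Fin n₁) (Fin n₂) ℝ) :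
    svGap k A - svGap k B ≤ nuclearNorm (A - B) := by
  set R := A - B with hR
  -- Cut the segment from B to A into N + 1 equal steps. The head terms telescope, so only the two
  -- end values survive, multiplied by the step length.
  have main : ∀ N : ℕ, svGap k A - svGap k B ≤
      nuclearNorm R + 4 * nuclearNorm R / ((N : ℝ) + 1) := by
    intro N
    set h : ℝ := 1 / ((N : ℝ) + 1) with hh
    have hpos : 0 < (N : ℝ) + 1 := by positivity
    have hh0 : 0 ≤ h := by positivity
    let P : ℕ → Matrix (Fin n₁) (Fin n₂) ℝ := fun j => B + ((j : ℝ) * h) • R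
    have hP : ∀ j, P (j + 1) = P j + h • R := by
      intro j
      simp only [P, Nat.cast_add, Nat.cast_one, add_mul, one_mul, add_smul, add_assoc]
    let S : ∀ j, SVD (P j) := fun j => (nonempty_SVD (P j)).some
    have hstep : ∀ j, svGap k (P (j + 1)) - svGap k (P j) ≤ h * (nuclearNorm R +
        2 * frobeniusInner R ((S (j + 1)).head k) - 2 * frobeniusInner R ((S j).head k)) := by
      intro j
      have key : ∀ (Q : Matrix (Fin n₁) (Fin n₂) ℝ) (S' : SVD Q), Q = P j + h • R →
          svGap k Q - svGap k (P j) ≤ h * (nuclearNorm R +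
            2 * frobeniusInner R (S'.head k) - 2 * frobeniusInner R ((S j).head k)) := by
        rintro Q S' rfl
        exact svGap_step k hh0 (S j) S'
      exact key _ _ (hP j)
    have hind : ∀ j, svGap k (P j) - svGap k (P 0) ≤ h * (j * nuclearNorm R +
        2 * frobeniusInner R ((S j).head k) - 2 * frobeniusInner R ((S 0).head k)) := by
      intro j
      induction j with
      | zero => simp
      | succ j ih =>
        have := hstep j
        push_cast
        nlinarith
    have hfin := hind (N + 1)
    have hP0 : svGap k (P 0) = svGap k B := by simp [P]
    have hPN : svGap k (P (N + 1)) = svGap k A := by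
      have : ((N + 1 : ℕ) : ℝ) * h = 1 := by
        push_cast
        rw [hh]
        field_simp
      simp only [P, this, one_smul, hR, add_sub_cancel]
    rw [hP0, hPN] at hfin
    have b1 := abs_le.mp ((S (N + 1)).abs_frobeniusInner_head_le k R)
    have b2 := abs_le.mp ((S 0).abs_frobeniusInner_head_le k R)
    refine hfin.trans ?_
    calc _ ≤ h * (((N : ℝ) + 1) * nuclearNorm R + 4 * nuclearNorm R) := by
          refine mul_le_mul_of_nonneg_left ?_ hh0
          push_cast
          linarith [b1.2, b2.1]
      _ = _ := by
          rw [hh]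
          field_simp
  have hlim : Filter.Tendsto (fun N : ℕ => nuclearNorm R + 4 * nuclearNorm R / ((N : ℝ) + 1))
      Filter.atTop (nhds (nuclearNorm R + 0)) := by
    refine Filter.Tendsto.const_add _ ?_
    have := (tendsto_one_div_add_atTop_nhds_zero_nat (𝕜 := ℝ)).const_mul (4 * nuclearNorm R)
    simpa only [mul_one_div, mul_zero] using this
  rw [add_zero] at hlim
  exact ge_of_tendsto' hlim main

/-- Testing the remainder against the full isometry of `X` gives this direction, without computing
the singular values of the remainder. -/
theorem SVD.nuclearNorm_sub_kyFan_le {X : Matrix (Fin n₁) (Fin n₂) ℝ} (S : SVD X) (k : ℕ) :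
    nuclearNorm X - kyFan k X ≤ nuclearNorm (X - S.trunc k) := by
  have htr : S.trunc k = dyadSum S.u S.v (fun i => if (i : ℕ) < k then sv X i else 0) := by
    rw [SVD.trunc, dyadSum_apply, Finset.sum_filter]
    refine Finset.sum_congr rfl fun i _ => ?_
    split_ifs <;> simp
  have h1 : X - S.trunc k =
      dyadSum S.u S.v (fun i => if (i : ℕ) < k then 0 else sv X i) := by
    rw [htr]
    refine sub_eq_of_eq_add (S.eq_dyadSum.trans ?_)
    rw [← map_add]
    congr 1
    ext i
    simp only [Pi.add_apply]
    split_ifs <;> simp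
  refine le_trans (le_of_eq ?_) (frobeniusInner_dyadSum_le_nuclearNorm S.orthonormal_u
    S.orthonormal_v 1 (by simp) (X - S.trunc k))
  rw [h1, frobeniusInner_dyadSum_self S.orthonormal_u S.orthonormal_v, nuclearNorm, kyFan,
    ← Finset.sum_sub_distrib]
  refine Finset.sum_congr rfl fun i _ => ?_
  split_ifs <;> simp

/-! ### From restricted isometry to the null space property. -/

/-- A linear functional on `{0 ≤ s ≤ a, ∑ s ≤ N a}` is at least its value at some `a • 1_P` with
`P` of size at most `N`. -/
theorem exists_subset_card_le_mul_sum_le {ι : Type*} [DecidableEq ι] (R : Finset ι) (N : ℕ) {a : ℝ}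
    (s f : ι → ℝ) (h0 : ∀ i ∈ R, 0 ≤ s i) (ha : ∀ i ∈ R, s i ≤ a) (hs : ∑ i ∈ R, s i ≤ N * a) :
    ∃ P ⊆ R, P.card ≤ N ∧ a * ∑ i ∈ P, f i ≤ ∑ i ∈ R, f i * s i := by
  obtain ⟨P, hP, hmin⟩ := Finset.exists_min_image (R.powerset.filter fun P => P.card ≤ N)
    (fun P => ∑ i ∈ P, f i) ⟨∅, by simp⟩
  simp only [Finset.mem_filter, Finset.mem_powerset] at hP hmin
  obtain ⟨hPR, hPN⟩ := hP
  refine ⟨P, hPR, hPN, ?_⟩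
  have hneg : ∀ i ∈ P, f i ≤ 0 := by
    intro i hi
    have := hmin (P.erase i) ⟨(P.erase_subset i).trans hPR, (P.card_erase_le).trans hPN⟩
    have h2 := P.add_sum_erase f hi
    linarith
  have hsplit : ∑ i ∈ R, f i * s i = ∑ i ∈ R \ P, f i * s i + ∑ i ∈ P, f i * s i :=
    (Finset.sum_sdiff hPR).symm
  have hsplit' : ∑ i ∈ R, s i = ∑ i ∈ R \ P, s i + ∑ i ∈ P, s i :=
    (Finset.sum_sdiff hPR).symm
  -- τ is a Lagrange multiplier: the difference of the two sides is at least τ(∑ s - |P| a) ≥ 0. It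
  -- is found by comparing the minimizer `P` with deletions, insertions and swaps.
  suffices H : ∃ τ : ℝ, τ ≤ 0 ∧ (∀ i ∈ P, f i ≤ τ) ∧ (∀ i ∈ R \ P, τ ≤ f i) ∧
      (τ = 0 ∨ P.card = N) by
    obtain ⟨τ, hτ, h1, h2, h3⟩ := H
    have e1 : ∑ i ∈ P, τ * (s i - a) ≤ ∑ i ∈ P, f i * (s i - a) :=
      Finset.sum_le_sum fun i hi =>
        mul_le_mul_of_nonpos_right (h1 i hi) (by linarith [ha i (hPR hi)])
    have e2 : ∑ i ∈ R \ P, τ * s i ≤ ∑ i ∈ R \ P, f i * s i :=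
      Finset.sum_le_sum fun i hi =>
        mul_le_mul_of_nonneg_right (h2 i hi) (h0 i (Finset.mem_sdiff.mp hi).1)
    rw [← Finset.mul_sum] at e1 e2
    simp only [mul_sub, Finset.sum_sub_distrib, ← Finset.sum_mul, Finset.sum_const,
      nsmul_eq_mul] at e1
    rw [hsplit]
    have e3 : 0 ≤ τ * (∑ i ∈ R, s i - P.card * a) := by
      rcases h3 with h3 | h3
      · simp [h3]
      · rw [h3]
        exact mul_nonneg_of_nonpos_of_nonpos hτ (by linarith)
    rw [hsplit'] at e3
    linarith
  rcases hPN.lt_or_eq with hlt | heq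
  · refine ⟨0, le_rfl, hneg, fun i hi => ?_, Or.inl rfl⟩
    obtain ⟨hiR, hiP⟩ := Finset.mem_sdiff.mp hi
    have := hmin (insert i P) ⟨Finset.insert_subset hiR hPR, by
      rw [Finset.card_insert_of_notMem hiP]; exact hlt⟩
    rw [Finset.sum_insert hiP] at this
    linarith
  · rcases P.eq_empty_or_nonempty with rfl | hne
    · have hle : ∀ i ∈ R, s i ≤ 0 := by
        simp only [Finset.card_empty] at heq
        rw [← heq] at hs
        simp only [Nat.cast_zero, zero_mul] at hs
        intro i hi
        exact (Finset.single_le_sum h0 hi).trans hs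
      obtain ⟨τ, hτ⟩ := (R.image f).bddBelow
      -- Here N = 0, so any nonpositive lower bound of `f` on `R` serves.
      refine ⟨min τ 0, min_le_right _ _, by simp, fun i hi => ?_, Or.inr heq⟩
      refine (min_le_left _ _).trans (hτ ?_)
      simpa using ⟨i, by simpa using hi, rfl⟩
    · refine ⟨P.sup' hne f, Finset.sup'_le _ _ hneg, fun i hi => Finset.le_sup' f hi,
        fun j hj => Finset.sup'_le _ _ fun i hi => ?_, Or.inr heq⟩
      obtain ⟨hjR, hjP⟩ := Finset.mem_sdiff.mp hj
      have hj' : j ∉ P.erase i := fun h => hjP (Finset.mem_of_mem_erase h)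
      have := hmin (insert j (P.erase i))
        ⟨Finset.insert_subset hjR ((P.erase_subset i).trans hPR), by
          rw [Finset.card_insert_of_notMem hj', Finset.card_erase_add_one hi]; exact hPN⟩
      rw [Finset.sum_insert hj', ← P.add_sum_erase f hi] at this
      linarith

section rip

variable {𝒜 : Matrix (Fin n₁) (Fin n₂) ℝ →ₗ[ℝ] EuclideanSpace ℝ (Fin m)} {r : ℕ} {δ : ℝ}
  {ι : Type*} [Fintype ι] {u : ι → EuclideanSpace ℝ (Fin n₁)} {v : ι → EuclideanSpace ℝ (Fin n₂)}

theorem frobeniusNorm_dyadSum_add_sq (hu : Orthonormal ℝ u) (hv : Orthonormal ℝ v) {c d : ι → ℝ}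
    (hcd : ∀ i, c i * d i = 0) (x y : ℝ) :
    frobeniusNorm (dyadSum u v (x • c + y • d)) ^ 2 =
      x ^ 2 * ∑ i, c i ^ 2 + y ^ 2 * ∑ i, d i ^ 2 := by
  rw [frobeniusNorm_dyadSum_sq hu hv, Finset.mul_sum, Finset.mul_sum, ← Finset.sum_add_distrib]
  refine Finset.sum_congr rfl fun i _ => ?_
  simp only [Pi.add_apply, Pi.smul_apply, smul_eq_mul]
  linear_combination (2 * x * y) * hcd i

/-- Subtract the upper RIP bound at (1-δ)c - δd from the lower one at (1+δ)c + δd. The terms ‖𝒜 d‖²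
cancel and a factor 2δ can be divided out; δ = 0 is treated apart by expanding ‖𝒜(c + d)‖². -/
theorem HasRIP.two_mul_inner_ge (hR : HasRIP 𝒜 r δ) (h0 : 0 ≤ δ) (hu : Orthonormal ℝ u)
    (hv : Orthonormal ℝ v) {s : Finset ι} (hs : s.card ≤ r) {c d : ι → ℝ}
    (hcd : ∀ i, c i * d i = 0) (hc : ∀ i ∉ s, c i = 0) (hd : ∀ i ∉ s, d i = 0) :
    (1 - δ ^ 2) * ∑ i, c i ^ 2 - δ ^ 2 * ∑ i, d i ^ 2 ≤
      2 * ⟪𝒜 (dyadSum u v c), 𝒜 (dyadSum u v (c + d))⟫_ℝ := by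
  have hrk : ∀ x y : ℝ, (dyadSum u v (x • c + y • d)).rank ≤ r := fun x y =>
    (rank_dyadSum_le s _ fun i hi => by simp [hc i hi, hd i hi]).trans hs
  have hn : ∀ x y : ℝ, ‖𝒜 (dyadSum u v (x • c + y • d))‖ ^ 2 =
      x ^ 2 * ⟪𝒜 (dyadSum u v c), 𝒜 (dyadSum u v c)⟫_ℝ +
        2 * (x * y) * ⟪𝒜 (dyadSum u v c), 𝒜 (dyadSum u v d)⟫_ℝ +
        y ^ 2 * ⟪𝒜 (dyadSum u v d), 𝒜 (dyadSum u v d)⟫_ℝ := by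
    intro x y
    rw [← real_inner_self_eq_norm_sq]
    simp only [map_add, map_smul, inner_add_left, inner_add_right, inner_smul_left,
      inner_smul_right, real_inner_comm (𝒜 (dyadSum u v c)) (𝒜 (dyadSum u v d))]
    simp only [conj_trivial]
    ring
  have hF := frobeniusNorm_dyadSum_add_sq hu hv hcd
  have key : ∀ x y : ℝ, _ := fun x y => hR _ (hrk x y)
  simp only [hn, hF] at key
  rw [map_add, map_add, inner_add_right]
  set P := ⟪𝒜 (dyadSum u v c), 𝒜 (dyadSum u v c)⟫_ℝ
  set Q := ⟪𝒜 (dyadSum u v c), 𝒜 (dyadSum u v d)⟫_ℝ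
  set W := ∑ i, c i ^ 2
  set U := ∑ i, d i ^ 2
  rcases h0.eq_or_lt with h | h
  · subst h
    have k1 := (key 1 0).1
    have k2 := (key 1 1).1
    have k3 := (key 1 0).2
    have k4 := (key 0 1).2
    have hW : 0 ≤ W := Finset.sum_nonneg fun i _ => sq_nonneg _
    linarith
  · have k1 := (key (1 + δ) δ).1
    have k2 := (key (1 - δ) (-δ)).2
    have : 2 * δ * ((1 - δ ^ 2) * W - δ ^ 2 * U) ≤ 2 * δ * (2 * (P + Q)) := by linarith
    exact le_of_mul_le_mul_left this (by positivity)

/-- A quadratic inequality `A x² ≤ 2 B x + C²` bounds `x`. -/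
theorem le_of_sq_mul_le {x A B C : ℝ} (hA : 0 < A) (hB : 0 ≤ B) (hC : 0 ≤ C)
    (h : A * x ^ 2 ≤ 2 * B * x + C ^ 2) : x ≤ 2 * B / A + C / √A := by
  by_contra! hlt
  have hs := Real.sqrt_pos.mpr hA
  have hsq := Real.sq_sqrt hA.le
  set q := √A
  have h1 : 0 ≤ 2 * B / A := by positivity
  have h2 : 0 ≤ C / q := by positivity
  have e1 : A * (2 * B / A) = 2 * B := by field_simp
  have e2 : q * (C / q) = C := by field_simp
  have hx : 0 < x := by linarith
  have h3 : A * (x - 2 * B / A) * x > A * (C / q) * (C / q) := by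
    have i1 : C / q < x - 2 * B / A := by linarith
    have i2 : C / q < x := by linarith
    have : (C / q) * (C / q) < (x - 2 * B / A) * x := mul_lt_mul'' i1 i2 h2 h2
    rw [gt_iff_lt, mul_assoc, mul_assoc]
    exact mul_lt_mul_of_pos_left this hA
  have e3 : A * (C / q) * (C / q) = C ^ 2 := by
    rw [← hsq, ← e2]; field_simp
  have e4 : A * (x - 2 * B / A) * x = A * x ^ 2 - (A * (2 * B / A)) * x := by ring
  rw [e3, e4, e1] at h3
  linarith

/-- The robust null space property implied by the restricted isometry property. -/
theorem HasRIP.sqrt_sum_sq_le [DecidableEq ι] {k M : ℕ} (hR : HasRIP 𝒜 (k + M) δ) (h0 : 0 ≤ δ)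
    (h1 : δ < 1) (hM : 0 < M) (hu : Orthonormal ℝ u) (hv : Orthonormal ℝ v) {T : Finset ι} (hT : T.card ≤ k)
    (s : ι → ℝ) (hs : ∀ i, 0 ≤ s i) :
    √(∑ i ∈ T, s i ^ 2) ≤ beta1 δ * ‖𝒜 (dyadSum u v s)‖ +
      δ / √(1 - δ ^ 2) * ((∑ i ∈ Finset.univ \ T, s i) / √M) := by
  set y := ∑ i ∈ Finset.univ \ T, s i with hy
  have hy0 : 0 ≤ y := Finset.sum_nonneg fun i _ => hs i
  have hM' : (0 : ℝ) < M := by exact_mod_cast hM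
  -- With the mean over M as threshold, at most M tail entries exceed it, and the others sum to at
  -- most (M - |L|) a.
  set a := y / M with ha
  have ha0 : 0 ≤ a := by positivity
  have hMa : M * a = y := by rw [ha]; field_simp
  let L := (Finset.univ \ T).filter fun i => a < s i
  let R := (Finset.univ \ T).filter fun i => ¬ a < s i
  have hLR : ∑ i ∈ L, s i + ∑ i ∈ R, s i = y := Finset.sum_filter_add_sum_filter_not _ _ _
  have hLa : L.card * a ≤ ∑ i ∈ L, s i := by
    rw [← nsmul_eq_mul]
    exact Finset.card_nsmul_le_sum _ _ _ fun i hi => (Finset.mem_filter.mp hi).2.le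
  have hR0 : 0 ≤ ∑ i ∈ R, s i := Finset.sum_nonneg fun i _ => hs i
  have hLM : L.card ≤ M := by
    rcases ha0.eq_or_lt with h | h
    · have hy0 : y = 0 := by rw [← hMa, ← h, mul_zero]
      have : L = ∅ := by
        refine Finset.filter_eq_empty_iff.mpr fun i hi => ?_
        have := Finset.single_le_sum (fun i _ => hs i) hi
        rw [← hy, hy0] at this
        rw [← h, not_lt]
        exact this
      simp [this]
    · have : (L.card : ℝ) * a ≤ M * a := by linarith
      exact_mod_cast le_of_mul_le_mul_right this h
  obtain ⟨P, hPR, hPc, hP⟩ := exists_subset_card_le_mul_sum_le R (M - L.card) (a := a) s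
    (fun i => ⟪𝒜 (dyadSum u v (fun i => if i ∈ T ∪ L then s i else 0)),
      𝒜 (dyadSum u v (Pi.single i 1))⟫_ℝ) (fun i _ => hs i)
    (fun i hi => not_lt.mp (Finset.mem_filter.mp hi).2) (by
      rw [Nat.cast_sub hLM, sub_mul]; linarith)
  set c : ι → ℝ := fun i => if i ∈ T ∪ L then s i else 0 with hc
  have hdecomp : ∀ g : ι → ℝ, ∀ Q : Finset ι, (fun i => if i ∈ Q then g i else 0) =
      ∑ i ∈ Q, g i • (Pi.single i 1 : ι → ℝ) := by
    intro g Q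
    ext j
    simp [Finset.sum_apply, Pi.single_apply]
  set d : ι → ℝ := fun i => if i ∈ P then a else 0 with hd
  have hmemR : ∀ i, i ∈ R ↔ i ∉ T ∪ L := by
    intro i
    simp only [R, L, Finset.mem_filter, Finset.mem_union, Finset.mem_sdiff, Finset.mem_univ,
      true_and]
    tauto
  have hsdec : s = c + fun i => if i ∈ R then s i else 0 := by
    ext i
    simp only [hc, Pi.add_apply, hmemR]
    split_ifs <;> simp_all
  -- Both sides share c; the choice of `P` makes the flat vector d pair with 𝒜 c no more than the
  -- small entries do.
  have hin : ⟪𝒜 (dyadSum u v c), 𝒜 (dyadSum u v (c + d))⟫_ℝ ≤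
      ⟪𝒜 (dyadSum u v c), 𝒜 (dyadSum u v s)⟫_ℝ := by
    conv_rhs => rw [hsdec]
    rw [map_add, map_add, inner_add_right, map_add, map_add, inner_add_right]
    refine add_le_add le_rfl ?_
    rw [hd, hdecomp (fun _ => a), hdecomp s R]
    simp only [map_sum, map_smul, inner_sum, inner_smul_right]
    rw [← Finset.mul_sum]
    refine hP.trans (le_of_eq ?_)
    exact Finset.sum_congr rfl fun i _ => mul_comm _ _
  have hcard : (T ∪ L ∪ P).card ≤ k + M := by
    have h1 := Finset.card_union_le (T ∪ L) P
    have h2 := Finset.card_union_le T L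
    omega
  have hpt := hR.two_mul_inner_ge h0 hu hv (s := T ∪ L ∪ P) hcard (c := c) (d := d)
    (fun i => by
      by_cases hi : i ∈ P
      · have := (hmemR i).mp (hPR hi)
        simp only [hc, if_neg this, zero_mul]
      · simp only [hd, if_neg hi, mul_zero])
    (fun i hi => if_neg fun h => hi (Finset.mem_union_left _ h))
    (fun i hi => if_neg fun h => hi (Finset.mem_union_right _ h))
  have hdsq : ∑ i, d i ^ 2 ≤ (y / √M) ^ 2 := by
    have : ∑ i, d i ^ 2 = P.card * a ^ 2 := by simp [hd, ite_pow]
    rw [this, div_pow y √M, Real.sq_sqrt hM'.le]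
    have hPM : (P.card : ℝ) ≤ M := by exact_mod_cast hPc.trans (Nat.sub_le _ _)
    calc (P.card : ℝ) * a ^ 2 ≤ M * a ^ 2 := by gcongr
      _ = y ^ 2 / M := by rw [ha]; field_simp
  set W := √(∑ i, c i ^ 2) with hW
  have hW0 : 0 ≤ W := Real.sqrt_nonneg _
  have hWsq : W ^ 2 = ∑ i, c i ^ 2 := Real.sq_sqrt (Finset.sum_nonneg fun i _ => sq_nonneg _)
  have hTW : √(∑ i ∈ T, s i ^ 2) ≤ W := by
    refine Real.sqrt_le_sqrt ?_
    calc ∑ i ∈ T, s i ^ 2 = ∑ i ∈ T, c i ^ 2 := Finset.sum_congr rfl fun i hi => by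
          simp only [hc, if_pos (Finset.mem_union_left L hi)]
      _ ≤ _ := Finset.sum_le_sum_of_subset_of_nonneg (Finset.subset_univ _)
          fun i _ _ => sq_nonneg _
  have hAc : ‖𝒜 (dyadSum u v c)‖ ≤ √(1 + δ) * W := by
    have h2 := (hR (dyadSum u v c) ((rank_dyadSum_le (T ∪ L) c fun i hi => if_neg hi).trans
      ((Finset.card_le_card Finset.subset_union_left).trans hcard))).2
    rw [frobeniusNorm_dyadSum_sq hu hv, ← hWsq] at h2
    refine abs_le_of_sq_le_sq' ?_ (by positivity) |>.2
    rw [mul_pow, Real.sq_sqrt (by linarith)]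
    exact h2
  refine hTW.trans ?_
  have hδ2 : 0 < 1 - δ ^ 2 := by nlinarith
  have hfin : (1 - δ ^ 2) * W ^ 2 ≤
      2 * (√(1 + δ) * ‖𝒜 (dyadSum u v s)‖) * W + (δ * (y / √M)) ^ 2 := by
    have hcs := real_inner_le_norm (𝒜 (dyadSum u v c)) (𝒜 (dyadSum u v s))
    have hcs' := mul_le_mul_of_nonneg_right hAc (norm_nonneg (𝒜 (dyadSum u v s)))
    have hd' := mul_le_mul_of_nonneg_left hdsq (sq_nonneg δ)
    rw [← hWsq] at hpt
    rw [mul_pow δ]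
    linarith
  have := le_of_sq_mul_le hδ2 (by positivity) (by positivity) hfin
  refine this.trans (le_of_eq ?_)
  congr 1
  · have e : 1 - δ ^ 2 = (1 - δ) * (√(1 + δ) * √(1 + δ)) := by
      rw [Real.mul_self_sqrt (by linarith)]; ring
    have hp : 0 < √(1 + δ) := Real.sqrt_pos.mpr (by linarith)
    have hm : 1 - δ ≠ 0 := by linarith
    rw [beta1, e]
    field_simp
  · ring

end rip

/-! ### The constants and the scalar inequalities. -/

theorem frobeniusNorm_sub_comm (A B : Matrix (Fin n₁) (Fin n₂) ℝ) :
    frobeniusNorm (A - B) = frobeniusNorm (B - A) := by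
  rw [← sq_eq_sq₀ (frobeniusNorm_nonneg _) (frobeniusNorm_nonneg _), frobeniusNorm_sq,
    frobeniusNorm_sq, ← neg_sub B A, map_neg, map_neg, LinearMap.neg_apply, neg_neg]

theorem beta1_pos {δ : ℝ} (h0 : 0 ≤ δ) (h1 : δ < 1) : 0 < beta1 δ :=
  div_pos two_pos (mul_pos (sub_pos.mpr h1) (Real.sqrt_pos.mpr (by linarith)))

theorem beta2_nonneg {t δ : ℝ} (h0 : 0 ≤ δ) : 0 ≤ beta2 t δ := div_nonneg h0 (Real.sqrt_nonneg _)

/-- Squared, both the assumption and the claim read δ² t < t - 1. -/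
theorem beta2_lt_one {t δ : ℝ} (ht : 1 < t) (h0 : 0 ≤ δ)
    (hδ : δ < √((t - 1) / t)) : beta2 t δ < 1 := by
  have h := (Real.lt_sqrt h0).mp hδ
  rw [lt_div_iff₀ (by linarith)] at h
  have h2 : 0 < (1 - δ ^ 2) * (t - 1) := mul_pos (by nlinarith) (by linarith)
  rw [beta2, div_lt_one (Real.sqrt_pos.mpr h2), Real.lt_sqrt h0]
  linarith

theorem div_sqrt_mul_div_sqrt_le {t δ k M y : ℝ} (ht : 1 < t) (h0 : 0 ≤ δ) (h1 : δ < 1)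
    (hk : 0 < k) (hM : k * (t - 1) ≤ M) (hy : 0 ≤ y) :
    δ / √(1 - δ ^ 2) * (y / √M) ≤ beta2 t δ * y / √k := by
  have hδ : 0 < 1 - δ ^ 2 := by nlinarith
  have ht' : 0 < t - 1 := by linarith
  have hM' : √k * √(t - 1) ≤ √M := by
    rw [← Real.sqrt_mul hk.le]
    exact Real.sqrt_le_sqrt hM
  have hs := Real.sqrt_pos.mpr ht'
  have hs' := Real.sqrt_pos.mpr hk
  calc δ / √(1 - δ ^ 2) * (y / √M) ≤ δ / √(1 - δ ^ 2) * (y / (√k * √(t - 1))) := by gcongr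
    _ = beta2 t δ * y / √k := by
      rw [beta2, Real.sqrt_mul hδ.le]
      field_simp

section arithmetic

variable {q b β lam ε r x y K σ F : ℝ}

/-- A root bound coarser than the exact one, but linear in σ: beyond it, r and r - 2a exceed 2a and
2λσ/a respectively. -/
theorem le_of_sq_sub_le {a : ℝ} (ha : 0 < a) (hlam : 0 ≤ lam) (hσ : 0 ≤ σ)
    (h : r ^ 2 - 2 * a * r ≤ 4 * lam * σ) : r ≤ 2 * lam / a * σ + 2 * a := by
  by_contra! hlt
  have h0 : 0 ≤ 2 * lam / a * σ := by positivity
  have e : 2 * a * (2 * lam / a * σ) = 4 * lam * σ := by field_simp; ring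
  have h1 : 2 * a * (2 * lam / a * σ) < r * (r - 2 * a) := by
    have : 2 * a * (2 * lam / a * σ) ≤ r * (2 * lam / a * σ) :=
      mul_le_mul_of_nonneg_right (by linarith) h0
    exact this.trans_lt (mul_lt_mul_of_pos_left (by linarith) (by linarith))
  rw [e] at h1
  linarith

/-- In the application q = √k, b = β₁, x and y are the ℓ² head and ℓ¹ tail of the error, and σ is ‖X
- X_[k]‖_*. -/
theorem error_bounds (hq : 0 < q) (hb : 0 < b) (hβ : 0 ≤ β) (hβ1 : β < 1) (hlam : 0 < lam)
    (hε : 0 ≤ ε) (hσ : 0 ≤ σ)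
    (h : r ^ 2 - 2 * ε * r ≤ 2 * lam * (2 * σ + K - y)) (hK : K ≤ q * x)
    (hx : x ≤ b * r + β * y / q) (hy : 0 ≤ y) (hF : F ≤ x + y) :
    r ≤ 2 * lam / (q * b * lam + ε) * σ + (2 * q * b * lam + 2 * ε) ∧
    F ≤ (2 * q * b * (2 * q + 1 + β) * lam + 2 * (q * β + 2 * β + q) * ε) /
          (q ^ 2 * b * (1 - β) * lam) * σ +
        (2 * (q ^ 2 + q) * b * lam + (β + 2 * q - q * β) * ε) /
          (q * (1 - β) * lam * (q * b * lam + ε)⁻¹) := by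
  obtain ⟨p, hp⟩ : ∃ p, p = q * b * lam := ⟨_, rfl⟩
  obtain ⟨a, ha⟩ : ∃ a, a = p + ε := ⟨_, rfl⟩
  have hp0 : 0 < p := by rw [hp]; positivity
  have ha0 : 0 < a := by rw [ha]; positivity
  have hβ' : 0 < 1 - β := by linarith
  have hqx : q * x ≤ q * b * r + β * y := by
    have := mul_le_mul_of_nonneg_left hx hq.le
    have e : q * (β * y / q) = β * y := by field_simp
    rw [mul_add, e] at this
    linarith
  have h1 : r ^ 2 - 2 * a * r ≤ 4 * lam * σ - 2 * lam * (1 - β) * y := by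
    have := mul_le_mul_of_nonneg_left (hK.trans hqx) (by linarith : 0 ≤ 2 * lam)
    rw [ha, hp]
    linarith
  have hr : r ≤ 2 * lam / a * σ + 2 * a :=
    le_of_sq_sub_le ha0 hlam.le hσ (by
      have : 0 ≤ 2 * lam * (1 - β) * y := by positivity
      linarith)
  have hpr : p * r ≤ 2 * lam * σ + 2 * p * a := by
    refine (mul_le_mul_of_nonneg_left hr hp0.le).trans ?_
    have e : p * (2 * lam / a * σ) = 2 * lam * σ * (p / a) := by field_simp
    have : p / a ≤ 1 := (div_le_one ha0).mpr (by linarith)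
    have h2 : 2 * lam * σ * (p / a) ≤ 2 * lam * σ * 1 := by gcongr
    linarith
  -- Completing the square: 2ar - r² ≤ a².
  have hyb : lam * (1 - β) * y ≤ 2 * lam * σ + a ^ 2 / 2 := by
    have := sq_nonneg (r - a)
    linarith
  constructor
  · rw [← hp, ← ha]
    refine hr.trans (le_of_eq ?_)
    rw [ha, hp]
    ring
  · have hqF : lam * (1 - β) * (q * F) ≤
        (1 - β) * (2 * lam * σ + 2 * p * a) + (q + β) * (2 * lam * σ + a ^ 2 / 2) := by
      have i1 : q * F ≤ q * b * r + (q + β) * y := by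
        have := mul_le_mul_of_nonneg_left hF hq.le
        linarith
      have i2 := mul_le_mul_of_nonneg_left i1 (by positivity : 0 ≤ lam * (1 - β))
      have i3 := mul_le_mul_of_nonneg_left hpr hβ'.le
      have i4 := mul_le_mul_of_nonneg_left hyb (by positivity : 0 ≤ q + β)
      have e : (1 - β) * (p * r) = lam * (1 - β) * (q * b * r) := by rw [hp]; ring
      linarith
    have hD : 0 < lam * (1 - β) * q := by positivity
    have e3 : (2 * q * b * (2 * q + 1 + β) * lam + 2 * (q * β + 2 * β + q) * ε) /
          (q ^ 2 * b * (1 - β) * lam) * σ =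
        ((2 * (2 * q + 1 + β) + 2 * (q * β + 2 * β + q) * ε / p) * lam * σ) /
          (lam * (1 - β) * q) := by
      rw [hp]
      field_simp
    have e4 : (2 * (q ^ 2 + q) * b * lam + (β + 2 * q - q * β) * ε) /
          (q * (1 - β) * lam * (q * b * lam + ε)⁻¹) =
        ((2 * (q + 1) * p + (β + 2 * q - q * β) * ε) * a) / (lam * (1 - β) * q) := by
      rw [← hp, ← ha, show 2 * (q ^ 2 + q) * b * lam = 2 * (q + 1) * p by rw [hp]; ring]
      field_simp
    rw [e3, e4, ← add_div, le_div_iff₀ hD]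
    have e5 : F * (lam * (1 - β) * q) = lam * (1 - β) * (q * F) := by ring
    rw [e5]
    refine hqF.trans ?_
    -- The stated constants exceed the derived ones; in the σ coefficient the whole ε term is slack.
    have j1 : 0 ≤ 2 * (q * β + 2 * β + q) * ε / p * (lam * σ) := by positivity
    have j2 : ((1 - β) * 2 + (q + β) * 2) * (lam * σ) ≤ 2 * (2 * q + 1 + β) * (lam * σ) :=
      mul_le_mul_of_nonneg_right (by linarith) (by positivity)
    have j3 : ((1 - β) * 2 * p + (q + β) * a / 2) * a ≤
        (2 * (q + 1) * p + (β + 2 * q - q * β) * ε) * a := by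
      refine mul_le_mul_of_nonneg_right ?_ ha0.le
      have l1 : 0 ≤ q * ε * (1 - β) := by positivity
      have l2 : 0 ≤ p * (1 - β) := by positivity
      have l3 : 0 ≤ q * p := by positivity
      have l4 : 0 ≤ q * ε := by positivity
      have l5 : 0 ≤ β * p := by positivity
      have l6 : 0 ≤ β * ε := by positivity
      rw [ha]
      linarith
    linarith

end arithmetic

/-! ### Optimality and the final assembly. -/

theorem sq_sub_le_of_isMinOn {𝒜 : Matrix (Fin n₁) (Fin n₂) ℝ →ₗ[ℝ] EuclideanSpace ℝ (Fin m)}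
    {X X' : Matrix (Fin n₁) (Fin n₂) ℝ} {b n : EuclideanSpace ℝ (Fin m)} {ε lam : ℝ}
    (hlam : 0 < lam) (hb : b = 𝒜 X + n) (hn : ‖n‖ ≤ ε)
    (hX' : IsMinOn (objective 𝒜 b lam) Set.univ X') :
    ‖𝒜 (X - X')‖ ^ 2 - 2 * ε * ‖𝒜 (X - X')‖ ≤ 2 * lam * (nuclearNorm X - nuclearNorm X') := by
  have h := isMinOn_univ_iff.mp hX' X
  -- Both residuals contain n, so ‖n‖² cancels and Cauchy-Schwarz handles the cross term.
  have e1 : b - 𝒜 X = n := by rw [hb]; abel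
  have e2 : b - 𝒜 X' = n + 𝒜 (X - X') := by rw [hb, map_sub]; abel
  rw [objective, objective, e1, e2, norm_add_sq_real] at h
  have hcs := (abs_le.mp ((abs_real_inner_le_norm n (𝒜 (X - X'))).trans
    (mul_le_mul_of_nonneg_right hn (norm_nonneg _)))).1
  have h' := mul_le_mul_of_nonneg_left h (by positivity : 0 ≤ 2 * lam)
  have e3 : ∀ u v : ℝ, 2 * lam * (u + 1 / (2 * lam) * v) = 2 * lam * u + v := by
    intro u v; field_simp
  rw [e3, e3] at h'
  linarith

end RNNM

theorem theorem1 (n₁ n₂ m : ℕ)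
    (𝒜 : Matrix (Fin n₁) (Fin n₂) ℝ →ₗ[ℝ] EuclideanSpace ℝ (Fin m))
    (k : ℕ) (hk : 0 < k) (t : ℝ) (ht : 1 < t)
    (δ : ℝ) (hRIC : RNNM.IsRIC 𝒜 (t * k) δ) (hδ : δ < √((t - 1) / t))
    (X : Matrix (Fin n₁) (Fin n₂) ℝ) (S : RNNM.SVD X)
    (ε lam : ℝ) (hlam : 0 < lam)
    (b n : EuclideanSpace ℝ (Fin m)) (hb : b = 𝒜 X + n) (hn : ‖n‖ ≤ ε)
    (X' : Matrix (Fin n₁) (Fin n₂) ℝ)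
    (hX' : IsMinOn (RNNM.objective 𝒜 b lam) Set.univ X') :
    ‖𝒜 (X' - X)‖ ≤
        RNNM.C1 lam ε k δ * RNNM.nuclearNorm (X - S.trunc k) + RNNM.C2 lam ε k δ ∧
      RNNM.frobeniusNorm (X' - X) ≤
        RNNM.C3 lam ε k δ t * RNNM.nuclearNorm (X - S.trunc k) + RNNM.C4 lam ε k δ t := by
  obtain ⟨⟨h0, h1, hR⟩, -⟩ := hRIC
  have hk' : (0 : ℝ) < k := by exact_mod_cast hk
  have hceil := Nat.le_ceil (t * k)
  have hlt : k < ⌈t * k⌉₊ := by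
    rw [Nat.lt_ceil]
    nlinarith
  -- The RIP rank is k + (M + 1): the positive surplus M + 1 ≥ k(t - 1) is the room for tail
  -- entries.
  obtain ⟨M, hM⟩ := Nat.exists_eq_add_of_lt hlt
  rw [add_assoc] at hM
  rw [hM] at hR hceil
  obtain ⟨S'⟩ := RNNM.nonempty_SVD (X - X')
  let T : Finset (Fin (min n₁ n₂)) := Finset.univ.filter fun i => (i : ℕ) < k
  have hT : T.card ≤ k := by
    rw [Fin.card_filter_val_lt]
    exact min_le_right _ _
  let s : Fin (min n₁ n₂) → ℝ := fun i => RNNM.sv (X - X') i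
  have hs : ∀ i, 0 ≤ s i := fun i => RNNM.sv_nonneg _ _
  have hy : 0 ≤ ∑ i ∈ Finset.univ \ T, s i := Finset.sum_nonneg fun i _ => hs i
  have hnull := hR.sqrt_sum_sq_le h0 h1 M.succ_pos S'.orthonormal_u S'.orthonormal_v hT s hs
  rw [← S'.eq_dyadSum] at hnull
  have hMk : (k : ℝ) * (t - 1) ≤ (M + 1 : ℕ) := by
    push_cast at hceil ⊢
    linarith
  have hx := hnull.trans (add_le_add le_rfl
    (RNNM.div_sqrt_mul_div_sqrt_le ht h0 h1 hk' hMk hy))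
  have hkf : RNNM.kyFan k (X - X') = ∑ i ∈ T, s i := (Finset.sum_filter _ _).symm
  have hnn : RNNM.nuclearNorm (X - X') = ∑ i ∈ Finset.univ \ T, s i + ∑ i ∈ T, s i :=
    (Finset.sum_sdiff (Finset.subset_univ T)).symm
  have hK : ∑ i ∈ T, s i ≤ √k * √(∑ i ∈ T, s i ^ 2) := by
    rw [← Real.sqrt_mul hk'.le]
    refine Real.le_sqrt_of_sq_le (sq_sum_le_card_mul_sum_sq.trans ?_)
    exact mul_le_mul_of_nonneg_right (by exact_mod_cast hT)
      (Finset.sum_nonneg fun i _ => sq_nonneg _)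
  -- The tail's ℓ² norm is at most its ℓ¹ norm.
  have hF : RNNM.frobeniusNorm (X - X') ≤
      √(∑ i ∈ T, s i ^ 2) + ∑ i ∈ Finset.univ \ T, s i := by
    refine abs_le_of_sq_le_sq' ?_ (by positivity) |>.2
    have e : RNNM.frobeniusNorm (X - X') ^ 2 =
        ∑ i ∈ Finset.univ \ T, s i ^ 2 + ∑ i ∈ T, s i ^ 2 := by
      rw [Finset.sum_sdiff (Finset.subset_univ T), S'.eq_dyadSum]
      exact RNNM.frobeniusNorm_dyadSum_sq S'.orthonormal_u S'.orthonormal_v _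
    have e1 := Real.sq_sqrt (Finset.sum_nonneg fun i (_ : i ∈ T) => sq_nonneg (s i))
    have e2 : ∑ i ∈ Finset.univ \ T, s i ^ 2 ≤ (∑ i ∈ Finset.univ \ T, s i) ^ 2 :=
      Finset.sum_sq_le_sq_sum_of_nonneg fun i _ => hs i
    have e3 := mul_nonneg (Real.sqrt_nonneg (∑ i ∈ T, s i ^ 2)) hy
    rw [e, add_sq, e1]
    linarith
  have hmin := RNNM.sq_sub_le_of_isMinOn hlam hb hn hX'
  have hgap := RNNM.svGap_sub_le k X (X - X')
  rw [sub_sub_cancel, RNNM.svGap, RNNM.svGap, hnn, hkf] at hgap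
  have hσ := S.nuclearNorm_sub_kyFan_le k
  have hopt : ‖𝒜 (X - X')‖ ^ 2 - 2 * ε * ‖𝒜 (X - X')‖ ≤
      2 * lam * (2 * RNNM.nuclearNorm (X - S.trunc k) + ∑ i ∈ T, s i -
        ∑ i ∈ Finset.univ \ T, s i) :=
    hmin.trans (mul_le_mul_of_nonneg_left (by linarith) (by positivity))
  have := RNNM.error_bounds (Real.sqrt_pos.mpr hk') (RNNM.beta1_pos h0 h1)
    (RNNM.beta2_nonneg (t := t) h0) (RNNM.beta2_lt_one ht h0 hδ) hlam ((norm_nonneg n).trans hn)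
    (RNNM.nuclearNorm_nonneg _) hopt hK hx hy hF
  rw [Real.sq_sqrt hk'.le] at this
  rw [← neg_sub X X', map_neg, norm_neg, neg_sub, RNNM.frobeniusNorm_sub_comm]
  exact this
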